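/- Let $K$ denote prefix-free Kolmogorov complexity: fix any optimal (universal) prefix-free machine $U$, i.e. a partial computable function $U$ from binary strings to binary strings with prefix-free domain such that for every partial computable $M$ with prefix-free domain there is a constant $d$ such that whenever $M(\sigma)=x$ there is $\tau$ with $U(\tau)=x$ and $|\tau|\le|\sigma|+d$; let $K(x)$ be the least length of a string $\sigma$ with $U(\sigma)=x$, and for $n\in\mathbb N$ let $K(n)$ be $K$ of the $n$-th binary string in length-lexicographic order. Let $\mu$ be a Borel probability measure on Cantor space $\{0,1\}^{\mathbb N}$, and write $\mu[x]$ for the measure of the set of infinite sequences extending the string $x$. Suppose that $\mu$ is $K$-trivial: there is a constant $c$ such that for all $n\in\mathbb N$ $$\sum_{|x|=n} K(x)\,\mu[x]\;\le\; K(n)+c .$$ Then $\mu$ has atoms, i.e. there is a point $Z$ with $\mu(\{Z\})>0$. In fact, $\mu$ is concentrated on its atoms: $\mu\big(\{0,1\}^{\mathbb N}\setminus\{Z:\mu(\{Z\})>0\}\big)=0$. -/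

import Mathlib

open MeasureTheory

/-- A prefix-free machine: a partial recursive function from binary strings to binary strings
whose domain is prefix-free. -/
structure IsPrefixFreeMachine (M : List Bool →. List Bool) : Prop where
  partrec : Partrec M
  prefixFree : ∀ σ τ : List Bool, (M σ).Dom → (M τ).Dom → σ <+: τ → σ = τ

/-- An optimal (universal) prefix-free machine `U`: every prefix-free machine `M` is simulated by
`U` with descriptions that are longer by at most an additive constant depending on `M`. -/
structure IsOptimalPrefixFreeMachine (U : List Bool →. List Bool) : Prop where
  machine : IsPrefixFreeMachine U
  optimal : ∀ M : List Bool →. List Bool, IsPrefixFreeMachine M →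
    ∃ d : ℕ, ∀ σ x : List Bool, x ∈ M σ → ∃ τ : List Bool, x ∈ U τ ∧ τ.length ≤ σ.length + d

/-- Prefix-free Kolmogorov complexity of the string `x` with respect to the machine `U`: the least
length of a `U`-description of `x`. -/
noncomputable def prefixComplexity (U : List Bool →. List Bool) (x : List Bool) : ℕ :=
  sInf {l : ℕ | ∃ σ : List Bool, x ∈ U σ ∧ σ.length = l}

/-- The standard (length-lexicographic) identification of natural numbers with binary strings:
`n` is the binary expansion of `n + 1`, most significant digit first, without its leading `1`. -/
def natString (n : ℕ) : List Bool := (Nat.bits (n + 1)).dropLast.reverse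

/-- The cylinder `[x]` of all infinite binary sequences that extend the string `x`. -/
def cantorCylinder (x : List Bool) : Set (ℕ → Bool) :=
  {Z | ∀ (i : ℕ) (h : i < x.length), Z i = x[i]}

/-- `K(μ ↾ n)`: the `μ`-average of the complexities `K(x)` over all strings `x` of length `n`. -/
noncomputable def averageComplexity (U : List Bool →. List Bool) (μ : Measure (ℕ → Bool))
    (n : ℕ) : ℝ :=
  ∑ x : Fin n → Bool,
    (prefixComplexity U (List.ofFn x) : ℝ) * μ.real (cantorCylinder (List.ofFn x))

/-- `μ` is `K`-trivial: `K(μ ↾ n) ≤ K(n) + O(1)`. -/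
def IsKTrivialMeasure (U : List Bool →. List Bool) (μ : Measure (ℕ → Bool)) : Prop :=
  ∃ c : ℕ, ∀ n : ℕ, averageComplexity U μ n ≤ (prefixComplexity U (natString n) : ℝ) + c

/-- The atoms of a measure on Cantor space: the points of positive measure. -/
def measureAtoms (μ : Measure (ℕ → Bool)) : Set (ℕ → Bool) := {Z | 0 < μ {Z}}

/-- Every string has a description, so the infimum defining its complexity is attained. -/
theorem IsOptimalPrefixFreeMachine.exists_description {U : List Bool →. List Bool}
    (hU : IsOptimalPrefixFreeMachine U) (x : List Bool) :
    ∃ σ : List Bool, x ∈ U σ ∧ σ.length = prefixComplexity U x := by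
  have hM : IsPrefixFreeMachine (fun σ => if σ = [] then Part.some x else Part.none) := by
    refine ⟨?_, ?_⟩
    · have h : Partrec fun σ : List Bool =>
          ((if σ = [] then some x else none : Option (List Bool)) : Part (List Bool)) :=
        Computable.ofOption
          (Primrec.ite (Primrec.eq.comp Primrec.id (Primrec.const []))
            (Primrec.const (some x)) (Primrec.const none)).to_comp
      refine h.of_eq fun σ => ?_
      split_ifs <;> rfl
    · intro σ τ h1 h2 _
      by_cases h3 : σ = []
      · by_cases h4 : τ = []
        · rw [h3, h4]
        · simp [h4] at h2
      · simp [h3] at h1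
  obtain ⟨d, hd⟩ := hU.optimal _ hM
  obtain ⟨τ, hτ, -⟩ := hd [] x (by simp)
  exact Nat.sInf_mem (s := {l : ℕ | ∃ σ : List Bool, x ∈ U σ ∧ σ.length = l}) ⟨_, τ, hτ, rfl⟩

namespace OptimalMachine

/-- Splits `1^e 0 σ` into `(e, σ)`. -/
def parse (p : List Bool) : Option (ℕ × List Bool) :=
  if p.findIdx (fun b => !b) < p.length then
    some (p.findIdx (fun b => !b), p.drop (p.findIdx (fun b => !b) + 1)) else none

theorem parse_eq_some {p σ : List Bool} {e : ℕ} :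
    parse p = some (e, σ) ↔ p = List.replicate e true ++ false :: σ := by
  induction p generalizing e with
  | nil => simp [parse]
  | cons b t ih =>
    cases b with
    | false =>
      cases e with
      | zero => simp [parse, List.findIdx_cons]
      | succ e => simp [parse, List.findIdx_cons, List.replicate_succ]
    | true =>
      cases e with
      | zero =>
        simp [parse, List.findIdx_cons]
      | succ e =>
        rw [List.replicate_succ, List.cons_append, List.cons.injEq, ← ih]
        simp [parse, List.findIdx_cons]

theorem parse_primrec : Primrec parse := by
  have hi : Primrec fun p : List Bool => p.findIdx (fun b => !b) :=
    Primrec.list_findIdx Primrec.id (Primrec.not.comp Primrec.snd)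
  exact Primrec.ite (Primrec.nat_lt.comp hi Primrec.list_length)
    (Primrec.option_some.comp
      (Primrec.pair hi (Primrec.list_drop.comp (Primrec.succ.comp hi) Primrec.id)))
    (Primrec.const none)

/-- The inputs `σ ≠ τ` are comparable. -/
def Comp (σ τ : List Bool) : Prop :=
  σ ≠ τ ∧ (σ = τ.take σ.length ∨ τ = σ.take τ.length)

instance (σ τ : List Bool) : Decidable (Comp σ τ) := by unfold Comp; infer_instance

/-- Some input that is comparable with `σ` is seen to halt within `k` steps of program `e`. -/
def Conflict (m : ℕ) (a : (ℕ × List Bool) × ℕ) : Prop :=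
  ((Nat.Partrec.Code.evaln a.2 (Denumerable.ofNat Nat.Partrec.Code a.1.1) m).isSome = true) ∧
    Comp a.1.2 ((Encodable.decode (α := List Bool) m).getD a.1.2)

instance (m : ℕ) (a : (ℕ × List Bool) × ℕ) : Decidable (Conflict m a) := by
  unfold Conflict; infer_instance

/-- One stage of the machine with index `e`, thinned out so that its domain is prefix-free. -/
def stage (a : ℕ × List Bool) (k : ℕ) : Option (List Bool) :=
  if ∃ m < k, Conflict m (a, k) then none else
    (Nat.Partrec.Code.evaln k (Denumerable.ofNat Nat.Partrec.Code a.1)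
      (Encodable.encode a.2)).bind fun v => Encodable.decode (α := List Bool) v

theorem conflict_primrec : PrimrecRel Conflict := by
  have hev : Primrec fun x : ℕ × ((ℕ × List Bool) × ℕ) =>
      Nat.Partrec.Code.evaln x.2.2 (Denumerable.ofNat Nat.Partrec.Code x.2.1.1) x.1 :=
    Nat.Partrec.Code.primrec_evaln.comp
      (Primrec.pair (Primrec.pair (Primrec.snd.comp Primrec.snd)
        ((Primrec.ofNat _).comp (Primrec.fst.comp (Primrec.fst.comp Primrec.snd)))) Primrec.fst)
  have hs : Primrec fun x : ℕ × ((ℕ × List Bool) × ℕ) => x.2.1.2 :=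
    Primrec.snd.comp (Primrec.fst.comp Primrec.snd)
  have ht : Primrec fun x : ℕ × ((ℕ × List Bool) × ℕ) =>
      (Encodable.decode (α := List Bool) x.1).getD x.2.1.2 :=
    Primrec.option_getD.comp (Primrec.decode.comp Primrec.fst) hs
  have h1 : PrimrecPred fun x : ℕ × ((ℕ × List Bool) × ℕ) =>
      (Nat.Partrec.Code.evaln x.2.2 (Denumerable.ofNat Nat.Partrec.Code x.2.1.1) x.1).isSome
        = true :=
    Primrec.eq.comp (Primrec.option_isSome.comp hev) (Primrec.const true)
  refine h1.and (PrimrecPred.and (PrimrecPred.not (Primrec.eq.comp hs ht)) ?_)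
  exact PrimrecPred.or
    (Primrec.eq.comp hs (Primrec.list_take.comp (Primrec.list_length.comp hs) ht))
    (Primrec.eq.comp ht (Primrec.list_take.comp (Primrec.list_length.comp ht) hs))

theorem stage_primrec : Primrec₂ stage := by
  have h1 : PrimrecPred fun a : (ℕ × List Bool) × ℕ => ∃ m < a.2, Conflict m a :=
    PrimrecPred.of_eq
      (PrimrecRel.comp (PrimrecRel.exists_mem_list conflict_primrec)
        (Primrec.list_range.comp Primrec.snd) Primrec.id) (by simp)
  refine Primrec.ite h1 (Primrec.const none) (Primrec.option_bind ?_ ?_)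
  · exact Nat.Partrec.Code.primrec_evaln.comp
      (Primrec.pair (Primrec.pair Primrec.snd
        ((Primrec.ofNat _).comp (Primrec.fst.comp Primrec.fst)))
        (Primrec.encode.comp (Primrec.snd.comp Primrec.fst)))
  · exact Primrec.decode.comp Primrec.snd

/-- The machine with index `e`, thinned out. -/
def run (a : ℕ × List Bool) : Part (List Bool) := Nat.rfindOpt (stage a)

/-- On input `1^e 0 σ`, run the thinned-out machine with index `e` on `σ`. -/
def machine (p : List Bool) : Part (List Bool) := (parse p : Part (ℕ × List Bool)).bind run

theorem machine_partrec : Partrec machine :=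
  (Computable.ofOption parse_primrec.to_comp).bind
    ((Partrec.rfindOpt stage_primrec.to_comp).comp Computable.snd)

theorem run_prefixFree {e : ℕ} {σ τ : List Bool} (h1 : (run (e, σ)).Dom) (h2 : (run (e, τ)).Dom)
    (h : σ <+: τ) : σ = τ := by
  by_contra hne
  obtain ⟨k, x, hx⟩ := Nat.rfindOpt_dom.1 h1
  obtain ⟨l, y, hy⟩ := Nat.rfindOpt_dom.1 h2
  have ht : σ = τ.take σ.length := List.prefix_iff_eq_take.1 h
  unfold stage at hx hy
  split_ifs at hx with c1
  · simp at hx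
  split_ifs at hy with c2
  · simp at hy
  obtain ⟨u, hu, -⟩ := Option.bind_eq_some_iff.1 hx
  obtain ⟨v, hv, -⟩ := Option.bind_eq_some_iff.1 hy
  rcases le_total k l with hkl | hkl
  · have hu' := Nat.Partrec.Code.evaln_mono hkl hu
    refine c2 ⟨Encodable.encode σ, Nat.Partrec.Code.evaln_bound hu', ?_, ?_⟩
    · exact Option.isSome_iff_exists.2 ⟨u, hu'⟩
    · simpa [Comp, Ne.symm hne] using Or.inr ht
  · have hv' := Nat.Partrec.Code.evaln_mono hkl hv
    refine c1 ⟨Encodable.encode τ, Nat.Partrec.Code.evaln_bound hv', ?_, ?_⟩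
    · exact Option.isSome_iff_exists.2 ⟨v, hv'⟩
    · simpa [Comp, hne] using Or.inl ht

theorem machine_prefixFree (p q : List Bool) (hp : (machine p).Dom) (hq : (machine q).Dom)
    (h : p <+: q) : p = q := by
  obtain ⟨x, hx⟩ := Part.dom_iff_mem.1 hp
  obtain ⟨y, hy⟩ := Part.dom_iff_mem.1 hq
  obtain ⟨⟨e, σ⟩, h1, h1'⟩ := Part.mem_bind_iff.1 hx
  obtain ⟨⟨e', τ⟩, h2, h2'⟩ := Part.mem_bind_iff.1 hy
  rw [Part.mem_coe] at h1 h2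
  have hp' := parse_eq_some.1 h1
  have hq' := parse_eq_some.1 h2
  obtain ⟨t, rfl⟩ := h
  have h3 : parse (p ++ t) = some (e, σ ++ t) := parse_eq_some.2 (by rw [hp']; simp)
  have h4 := Option.some.inj (h3.symm.trans h2)
  obtain ⟨rfl, rfl⟩ := Prod.mk.inj h4
  have h5 := run_prefixFree (Part.dom_iff_mem.2 ⟨x, h1'⟩) (Part.dom_iff_mem.2 ⟨y, h2'⟩)
    (List.prefix_append σ t)
  simpa using h5

theorem run_complete {M : List Bool →. List Bool} (hM : IsPrefixFreeMachine M) :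
    ∃ e : ℕ, ∀ σ x : List Bool, x ∈ M σ → x ∈ run (e, σ) := by
  obtain ⟨c, hc⟩ := Nat.Partrec.Code.exists_code.1 hM.partrec
  have hev : ∀ (σ : List Bool) (v : ℕ), v ∈ c.eval (Encodable.encode σ) ↔
      ∃ x ∈ M σ, Encodable.encode x = v := by
    intro σ v
    rw [hc]
    simp
  have hno : ∀ (σ : List Bool) (k : ℕ), (M σ).Dom →
      ¬ ∃ m < k, Conflict m ((Encodable.encode c, σ), k) := by
    rintro σ k hσ ⟨m, -, h1, h2⟩
    obtain ⟨v, hv⟩ := Option.isSome_iff_exists.1 h1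
    simp only [Denumerable.ofNat_encode] at hv
    have hv := Nat.Partrec.Code.evaln_sound hv
    cases hm : Encodable.decode (α := List Bool) m with
    | none => simp [hm, Comp] at h2
    | some τ =>
      rw [hc] at hv
      simp only [hm, Option.getD_some] at h2
      have hτ : (M τ).Dom := by
        simp [hm] at hv
        obtain ⟨x, hx, -⟩ := hv
        exact Part.dom_iff_mem.2 ⟨x, hx⟩
      rcases h2.2 with h3 | h3
      · exact h2.1 (hM.prefixFree _ _ hσ hτ (List.prefix_iff_eq_take.2 h3))
      · exact h2.1 (hM.prefixFree _ _ hτ hσ (List.prefix_iff_eq_take.2 h3)).symm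
  refine ⟨Encodable.encode c, fun σ x hx => ?_⟩
  have hσ : (M σ).Dom := Part.dom_iff_mem.2 ⟨x, hx⟩
  have hst : ∀ k y, y ∈ stage (Encodable.encode c, σ) k → y = x := by
    intro k y hy
    unfold stage at hy
    rw [if_neg (hno σ k hσ)] at hy
    obtain ⟨v, hv, hy⟩ := Option.bind_eq_some_iff.1 hy
    simp only [Denumerable.ofNat_encode] at hv
    obtain ⟨z, hz, rfl⟩ := (hev σ v).1 (Nat.Partrec.Code.evaln_sound hv)
    rw [Encodable.encodek] at hy
    exact (Option.some.inj hy).symm.trans (Part.mem_unique hz hx)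
  obtain ⟨k, hk⟩ := Nat.Partrec.Code.evaln_complete.1 ((hev σ _).2 ⟨x, hx, rfl⟩)
  have hxk : x ∈ stage (Encodable.encode c, σ) k := by
    unfold stage
    rw [if_neg (hno σ k hσ)]
    refine Option.bind_eq_some_iff.2 ⟨_, ?_, Encodable.encodek x⟩
    rw [Denumerable.ofNat_encode]
    exact hk
  have hd : (run (Encodable.encode c, σ)).Dom := Nat.rfindOpt_dom.2 ⟨k, x, hxk⟩
  obtain ⟨y, hy⟩ := Part.dom_iff_mem.1 hd
  obtain ⟨l, hl⟩ := Nat.rfindOpt_spec hy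
  rwa [hst l y hl] at hy

end OptimalMachine

/-- Optimal prefix-free machines exist. -/
theorem exists_isOptimalPrefixFreeMachine :
    ∃ U : List Bool →. List Bool, IsOptimalPrefixFreeMachine U := by
  refine ⟨OptimalMachine.machine,
    ⟨OptimalMachine.machine_partrec, OptimalMachine.machine_prefixFree⟩, fun M hM => ?_⟩
  obtain ⟨e, he⟩ := OptimalMachine.run_complete hM
  refine ⟨e + 1, fun σ x hx => ⟨List.replicate e true ++ false :: σ, ?_, ?_⟩⟩
  · exact Part.mem_bind_iff.2
      ⟨(e, σ), Part.mem_coe.2 (OptimalMachine.parse_eq_some.2 rfl), he σ x hx⟩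
  · simp
    omega

/-! Only few strings of length n have complexity near K(n), while K-triviality puts almost all the
mass on such strings. Counting: at most 4^(b+d) strings x of length n satisfy K(x) ≤ K(n) + b
(`IsOptimalPrefixFreeMachine.exists_card_le`). Too many short descriptions of strings of length n
would pay, through Kraft–Chaitin (`exists_machine_of_requests`), for a description of n shorter than
K(n). Averaging: K(n) ≤ K(x) + O(1) when |x| = n, so K(x) - K(n) is bounded below and has bounded
μ-average. By Markov's inequality the strings with K(x) > K(n) + b carry mass O(1/b)
(`exists_sum_measureReal_le`). Conclusion: let ν be μ restricted to the complement of its atoms. By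
compactness the cylinders of ν are uniformly small at some length n
(`exists_measure_cantorCylinder_lt`), so the few strings with K(x) ≤ K(n) + b have ν-mass at most
1/(b+1). Thus ν has total mass O(1/b) for every b, hence mass 0. -/

open scoped ENNReal

/-! ### Binary values and the numbering of strings -/

/-- The value of the binary expansion `σ`, most significant digit first, read after the digits of
the number `a`. -/
def binVal (a : ℕ) (σ : List Bool) : ℕ := σ.foldl (fun a b => 2 * a + b.toNat) a

@[simp] theorem binVal_nil (a : ℕ) : binVal a [] = a := rfl

theorem binVal_append (a : ℕ) (σ τ : List Bool) : binVal a (σ ++ τ) = binVal (binVal a σ) τ := by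
  simp [binVal]

theorem binVal_concat (a : ℕ) (σ : List Bool) (b : Bool) :
    binVal a (σ ++ [b]) = 2 * binVal a σ + b.toNat := by
  simp [binVal]

theorem binVal_eq (a : ℕ) (σ : List Bool) : binVal a σ = a * 2 ^ σ.length + binVal 0 σ := by
  induction σ using List.reverseRecOn with
  | nil => simp
  | append_singleton σ b ih => rw [binVal_concat, binVal_concat, ih]; simp; ring

theorem binVal_lt (σ : List Bool) : binVal 0 σ < 2 ^ σ.length := by
  induction σ using List.reverseRecOn with
  | nil => simp
  | append_singleton σ b ih =>
    rw [binVal_concat]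
    have := Bool.toNat_le b
    simp only [List.length_append, List.length_singleton, pow_succ]
    omega

theorem exists_binVal_eq {l v : ℕ} (h : v < 2 ^ l) :
    ∃ σ : List Bool, σ.length = l ∧ binVal 0 σ = v := by
  induction l generalizing v with
  | zero => exact ⟨[], rfl, by simp at h; simp [h]⟩
  | succ l ih =>
    obtain ⟨σ, h1, h2⟩ := ih (v := v / 2) (by rw [pow_succ] at h; omega)
    refine ⟨σ ++ [decide (v % 2 = 1)], by simp [h1], ?_⟩
    rw [binVal_concat, h2]
    rcases Nat.mod_two_eq_zero_or_one v with h | h <;> simp [h] <;> omega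

theorem binVal_primrec : Primrec₂ binVal := by
  have hb : Primrec Bool.toNat := Primrec.dom_finite _
  exact Primrec.list_foldl (α := ℕ × List Bool) (σ := ℕ)
    (h := fun _ p => 2 * p.1 + p.2.toNat) Primrec.snd Primrec.fst
    (Primrec.nat_add.comp
      (Primrec.nat_mul.comp (Primrec.const 2) (Primrec.fst.comp Primrec.snd))
      (hb.comp (Primrec.snd.comp Primrec.snd)))

theorem natString_zero : natString 0 = [] := by simp [natString]

theorem natString_bit (n : ℕ) (b : Bool) :
    natString (2 * n + 1 + b.toNat) = natString n ++ [b] := by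
  have h1 : (Nat.bits (n + 1)) ≠ [] := by
    intro h
    have := congrArg List.length h
    rw [Nat.size_eq_bits_len] at this
    simp [Nat.size_eq_zero] at this
  have h2 : 2 * n + 1 + b.toNat + 1 = Nat.bit b (n + 1) := by
    cases b <;> simp [Nat.bit_val] <;> ring
  rw [natString, h2, Nat.bits_append_bit _ _ (by simp), natString,
    List.dropLast_cons_of_ne_nil h1, List.reverse_cons]

theorem binVal_one_natString (n : ℕ) : binVal 1 (natString n) = n + 1 := by
  induction n using Nat.strong_induction_on with
  | _ n ih =>
    rcases Nat.eq_zero_or_pos n with rfl | hn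
    · simp [natString_zero]
    · obtain ⟨m, b, rfl⟩ : ∃ m, ∃ b : Bool, n = 2 * m + 1 + b.toNat := by
        refine ⟨(n - 1) / 2, decide (n % 2 = 0), ?_⟩
        rcases Nat.mod_two_eq_zero_or_one n with h | h <;> simp [h] <;> omega
      rw [natString_bit, binVal_concat, ih m (by omega)]
      ring

/-- The leading digit 1 preserves the zeros at the front of the string, so `natString` recovers it.
-/
theorem binVal_one_injective : Function.Injective (binVal 1) := by
  suffices h : Function.LeftInverse (fun n => natString (n - 1)) (binVal 1) from h.injective
  intro σ
  induction σ using List.reverseRecOn with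
  | nil => simp [natString_zero]
  | append_singleton σ b ih =>
    have h1 : binVal 1 σ ≠ 0 := by
      rw [binVal_eq]; positivity
    have h2 : binVal 1 (σ ++ [b]) - 1 = 2 * (binVal 1 σ - 1) + 1 + b.toNat := by
      rw [binVal_concat]; omega
    simp only [h2, natString_bit]
    exact congrArg (· ++ [b]) ih

/-- Unbounded search for the unique string at which the primitive recursive injection `binVal 1`
takes the value n + 1. -/
theorem natString_computable : Computable natString := by
  have hf : Primrec₂ fun (n e : ℕ) => (Encodable.decode (α := List Bool) e).bind
      fun σ => if binVal 1 σ = n + 1 then some σ else none := by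
    refine Primrec.option_bind (Primrec.decode.comp Primrec.snd) ?_
    refine Primrec.ite (Primrec.eq.comp (binVal_primrec.comp (Primrec.const 1) Primrec.snd)
      (Primrec.succ.comp (Primrec.fst.comp Primrec.fst)))
      (Primrec.option_some.comp Primrec.snd) (Primrec.const none)
  refine (Partrec.rfindOpt hf.to_comp).of_eq fun n => ?_
  have key : ∀ e σ, σ ∈ (Encodable.decode (α := List Bool) e).bind
      (fun σ => if binVal 1 σ = n + 1 then some σ else none) → σ = natString n := by
    intro e σ h
    obtain ⟨τ, -, hτ⟩ := Option.bind_eq_some_iff.1 h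
    split_ifs at hτ with h1
    obtain rfl := Option.some.inj hτ
    exact binVal_one_injective (h1.trans (binVal_one_natString n).symm)
  have hd := (Nat.rfindOpt_dom (f := fun e => (Encodable.decode (α := List Bool) e).bind
      fun σ => if binVal 1 σ = n + 1 then some σ else none)).2 ⟨Encodable.encode (natString n), natString n,
    show natString n ∈ (Encodable.decode (α := List Bool) (Encodable.encode (natString n))).bind
      (fun σ => if binVal 1 σ = n + 1 then some σ else none) by
      simp [binVal_one_natString]⟩
  obtain ⟨σ, hσ⟩ := Part.dom_iff_mem.1 hd
  obtain ⟨e, he⟩ := Nat.rfindOpt_spec hσ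
  rw [key e σ he] at hσ
  exact Part.eq_some_iff.2 hσ

/-! ### Dyadic intervals and Kraft's inequality -/

/-- The dyadic interval of the reals whose binary expansion starts with `σ`. -/
def dyadicInterval (σ : List Bool) : Set ℝ :=
  Set.Ico ((binVal 0 σ : ℝ) / 2 ^ σ.length) ((binVal 0 σ + 1 : ℝ) / 2 ^ σ.length)

theorem left_mem_dyadicInterval (σ : List Bool) :
    (binVal 0 σ : ℝ) / 2 ^ σ.length ∈ dyadicInterval σ :=
  ⟨le_rfl, by gcongr; linarith⟩

theorem dyadicInterval_anti {σ τ : List Bool} (h : σ <+: τ) :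
    dyadicInterval τ ⊆ dyadicInterval σ := by
  obtain ⟨ρ, rfl⟩ := h
  have h1 : binVal 0 (σ ++ ρ) = binVal 0 σ * 2 ^ ρ.length + binVal 0 ρ := by
    rw [binVal_append, binVal_eq]
  have h2 : (binVal 0 ρ : ℝ) + 1 ≤ 2 ^ ρ.length := by exact_mod_cast binVal_lt ρ
  apply Set.Ico_subset_Ico
  · rw [div_le_div_iff₀ (by positivity) (by positivity), h1, List.length_append, pow_add]
    push_cast
    have : (0 : ℝ) ≤ binVal 0 ρ * 2 ^ σ.length := by positivity
    linarith
  · rw [div_le_div_iff₀ (by positivity) (by positivity), h1, List.length_append, pow_add]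
    push_cast
    have : ((binVal 0 ρ : ℝ) + 1) * 2 ^ σ.length ≤ 2 ^ ρ.length * 2 ^ σ.length := by gcongr
    linarith

/-- Truncating τ to the length of σ only enlarges its interval. Two intervals of the same dyadic
level that meet coincide, because their integer numerators differ by less than 1. -/
theorem prefix_of_dyadicInterval_inter {σ τ : List Bool} {r : ℝ} (hσ : r ∈ dyadicInterval σ)
    (hτ : r ∈ dyadicInterval τ) (h : σ.length ≤ τ.length) : σ <+: τ := by
  have h1 := dyadicInterval_anti (List.take_prefix σ.length τ) hτ
  have hl : (τ.take σ.length).length = σ.length := by simp [h]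
  rw [List.prefix_iff_eq_take]
  apply binVal_one_injective
  rw [binVal_eq, binVal_eq 1 (τ.take _), hl, add_right_inj]
  obtain ⟨a1, a2⟩ := hσ
  obtain ⟨b1, b2⟩ := h1
  rw [hl] at b1 b2
  have hp : (0 : ℝ) < 2 ^ σ.length := by positivity
  rw [div_le_iff₀ hp] at a1 b1
  rw [lt_div_iff₀ hp] at a2 b2
  have c1 : (binVal 0 σ : ℝ) < binVal 0 (τ.take σ.length) + 1 := a1.trans_lt b2
  have c2 : (binVal 0 (τ.take σ.length) : ℝ) < binVal 0 σ + 1 := b1.trans_lt a2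
  norm_cast at c1 c2
  omega

theorem volume_dyadicInterval (σ : List Bool) :
    volume (dyadicInterval σ) = (2⁻¹ : ENNReal) ^ σ.length := by
  rw [dyadicInterval, Real.volume_Ico, ← sub_div, add_sub_cancel_left, one_div,
    ENNReal.ofReal_inv_of_pos (by positivity), ENNReal.ofReal_pow (by norm_num), ENNReal.inv_pow]
  simp

/-- **Kraft's inequality** for a prefix-free set of binary strings. -/
theorem kraft_inequality {S : Set (List Bool)}
    (hS : ∀ σ ∈ S, ∀ τ ∈ S, σ <+: τ → σ = τ) :
    ∑' σ : S, (2⁻¹ : ENNReal) ^ σ.1.length ≤ 1 := by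
  have hd : Pairwise (Function.onFun Disjoint fun σ : S => dyadicInterval σ.1) := by
    intro σ τ hne
    refine Set.disjoint_left.2 fun r h1 h2 => hne (Subtype.ext ?_)
    rcases le_total σ.1.length τ.1.length with h | h
    · exact hS _ σ.2 _ τ.2 (prefix_of_dyadicInterval_inter h1 h2 h)
    · exact (hS _ τ.2 _ σ.2 (prefix_of_dyadicInterval_inter h2 h1 h)).symm
  calc ∑' σ : S, (2⁻¹ : ENNReal) ^ σ.1.length
      = volume (⋃ σ : S, dyadicInterval σ.1) := by
        rw [measure_iUnion hd fun σ => measurableSet_Ico]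
        exact tsum_congr fun σ => (volume_dyadicInterval _).symm
    _ ≤ volume (Set.Ico (0 : ℝ) 1) := by
        refine measure_mono (Set.iUnion_subset fun σ => ?_)
        refine (dyadicInterval_anti (List.nil_prefix (l := σ.1))).trans ?_
        simp [dyadicInterval]
    _ = 1 := by simp

/-! ### The Kraft–Chaitin theorem -/

/-- The Kraft weight of a request `(l, y)`, asking for a description of `y` of length `l`. -/
noncomputable def requestWeight (o : Option (ℕ × List Bool)) : ℝ := o.elim 0 fun p => 2⁻¹ ^ p.1

theorem requestWeight_nonneg (o : Option (ℕ × List Bool)) : 0 ≤ requestWeight o := by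
  cases o <;> simp [requestWeight]

/-- The total weight of the requests issued before stage `s`, as a multiple of `2 ^ (-s)`. -/
def requestSum (r : ℕ → Option (ℕ × List Bool)) (s : ℕ) : ℕ :=
  Nat.rec 0 (fun t n => 2 * n + (r t).elim 0 fun p => 2 ^ (t + 1 - p.1)) s

/-- The output on input `σ` if `σ` is the description that is assigned to the request of
stage `s`. -/
def requestStage (r : ℕ → Option (ℕ × List Bool)) (σ : List Bool) (s : ℕ) : Option (List Bool) :=
  (r s).bind fun p =>
    if σ.length = p.1 + 1 ∧ requestSum r s * 2 ^ (p.1 + 1) ≤ binVal 0 σ * 2 ^ s ∧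
      binVal 0 σ * 2 ^ s < requestSum r s * 2 ^ (p.1 + 1) + 2 ^ s then some p.2 else none

section

variable {r : ℕ → Option (ℕ × List Bool)}

theorem primrec_nat_pow : Primrec₂ fun a b : ℕ => a ^ b := by
  have h : Primrec₂ fun a b : ℕ => Nat.rec (motive := fun _ => ℕ) 1 (fun _ m => m * a) b :=
    Primrec.nat_rec (Primrec.const 1) (Primrec.nat_mul.comp (Primrec.snd.comp Primrec.snd)
      Primrec.fst).to₂
  refine h.of_eq fun a b => ?_
  induction b with
  | zero => rfl
  | succ b ih => rw [pow_succ, ← ih]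

theorem requestSum_primrec (hr : Primrec r) : Primrec (requestSum r) := by
  refine Primrec.nat_rec' (α := ℕ) (β := ℕ) (f := fun s => s) (g := fun _ => 0)
    (h := fun _ q => 2 * q.2 + (r q.1).elim 0 fun p => 2 ^ (q.1 + 1 - p.1))
    Primrec.id (Primrec.const 0) ?_
  refine Primrec.nat_add.comp
    (Primrec.nat_mul.comp (Primrec.const 2) (Primrec.snd.comp Primrec.snd)) ?_
  have h := Primrec.option_casesOn (α := ℕ × ℕ × ℕ) (β := ℕ × List Bool) (σ := ℕ)
    (o := fun x => r x.2.1) (f := fun _ => 0) (g := fun x p => 2 ^ (x.2.1 + 1 - p.1))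
    (hr.comp (Primrec.fst.comp Primrec.snd)) (Primrec.const 0)
    (primrec_nat_pow.comp (Primrec.const 2) (Primrec.nat_sub.comp
      (Primrec.succ.comp (Primrec.fst.comp (Primrec.snd.comp Primrec.fst)))
      (Primrec.fst.comp Primrec.snd)))
  refine h.of_eq fun x => ?_
  cases r x.2.1 <;> rfl

theorem requestStage_primrec (hr : Primrec r) : Primrec₂ (requestStage r) := by
  refine Primrec.option_bind (α := List Bool × ℕ) (hr.comp Primrec.snd) ?_
  have hσ : Primrec fun q : (List Bool × ℕ) × ℕ × List Bool => q.1.1 :=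
    Primrec.fst.comp Primrec.fst
  have hs : Primrec fun q : (List Bool × ℕ) × ℕ × List Bool => q.1.2 :=
    Primrec.snd.comp Primrec.fst
  have hl : Primrec fun q : (List Bool × ℕ) × ℕ × List Bool => q.2.1 + 1 :=
    Primrec.succ.comp (Primrec.fst.comp Primrec.snd)
  have h2s := primrec_nat_pow.comp (Primrec.const 2) hs
  have hN := Primrec.nat_mul.comp ((requestSum_primrec hr).comp hs)
    (primrec_nat_pow.comp (Primrec.const 2) hl)
  have hv := Primrec.nat_mul.comp (binVal_primrec.comp (Primrec.const 0) hσ) h2s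
  refine Primrec.ite (PrimrecPred.and (Primrec.eq.comp (Primrec.list_length.comp hσ) hl)
    (PrimrecPred.and (Primrec.nat_le.comp hN hv)
      (Primrec.nat_lt.comp hv (Primrec.nat_add.comp hN h2s)))) ?_ (Primrec.const none)
  exact Primrec.option_some.comp (Primrec.snd.comp Primrec.snd)

/-- The bound `hl` makes the partial sums integer multiples of 2^(-s) and keeps the natural
subtraction in `requestSum` from truncating. The allocation of descriptions can therefore be
computed in ℕ. -/
theorem requestSum_eq (hl : ∀ s p, r s = some p → p.1 ≤ s) (s : ℕ) :
    (requestSum r s : ℝ) / 2 ^ s = ∑ j ∈ Finset.range s, requestWeight (r j) := by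
  induction s with
  | zero => simp [requestSum]
  | succ s ih =>
    have h : requestSum r (s + 1) =
      2 * requestSum r s + (r s).elim 0 fun p => 2 ^ (s + 1 - p.1) := rfl
    rw [Finset.sum_range_succ, ← ih, h]
    cases h' : r s with
    | none => simp [requestWeight, pow_succ]; field_simp
    | some p =>
      have := hl s p h'
      simp only [requestWeight, Option.elim_some]
      push_cast
      rw [pow_sub₀ _ (by norm_num) (by omega), inv_pow, pow_succ]
      field_simp

theorem requestStage_eq_some {σ y : List Bool} {s : ℕ} (h : requestStage r σ s = some y) :
    ∃ p, r s = some p ∧ p.2 = y ∧ σ.length = p.1 + 1 ∧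
      requestSum r s * 2 ^ (p.1 + 1) ≤ binVal 0 σ * 2 ^ s ∧
      binVal 0 σ * 2 ^ s < requestSum r s * 2 ^ (p.1 + 1) + 2 ^ s := by
  obtain ⟨p, hp, h⟩ := Option.bind_eq_some_iff.1 h
  split_ifs at h with h1
  exact ⟨p, hp, Option.some.inj h, h1⟩

/-- The request of stage s owns the interval between consecutive partial sums, of length 2^(-p.1),
whose left end need not be dyadic of level p.1. The first grid interval of half that length starting
at or after the left end still fits inside; this is the lost bit. -/
theorem subset_of_request (hl : ∀ s p, r s = some p → p.1 ≤ s) {v s : ℕ} {p : ℕ × List Bool}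
    (hp : r s = some p) (h2 : requestSum r s * 2 ^ (p.1 + 1) ≤ v * 2 ^ s)
    (h3 : v * 2 ^ s < requestSum r s * 2 ^ (p.1 + 1) + 2 ^ s) :
    ∑ j ∈ Finset.range s, requestWeight (r j) ≤ (v : ℝ) / 2 ^ (p.1 + 1) ∧
    ((v : ℝ) + 1) / 2 ^ (p.1 + 1) ≤ ∑ j ∈ Finset.range (s + 1), requestWeight (r j) := by
  have h2' : (requestSum r s : ℝ) * 2 ^ (p.1 + 1) ≤ v * 2 ^ s := by exact_mod_cast h2
  have h3' : (v : ℝ) * 2 ^ s < requestSum r s * 2 ^ (p.1 + 1) + 2 ^ s := by exact_mod_cast h3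
  rw [Finset.sum_range_succ, ← requestSum_eq hl]
  refine ⟨?_, ?_⟩
  · rwa [div_le_div_iff₀ (by positivity) (by positivity)]
  · rw [hp, requestWeight, Option.elim_some, div_le_iff₀ (by positivity)]
    have hs : (0 : ℝ) < 2 ^ s := by positivity
    have e : ((requestSum r s : ℝ) / 2 ^ s + 2⁻¹ ^ p.1) * 2 ^ (p.1 + 1) =
        (requestSum r s * 2 ^ (p.1 + 1) + 2 * 2 ^ s) / 2 ^ s := by
      rw [pow_succ, inv_pow]; field_simp
    rw [e, le_div_iff₀ hs]
    linarith

theorem dyadicInterval_subset_of_request (hl : ∀ s p, r s = some p → p.1 ≤ s)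
    {σ y : List Bool} {s : ℕ} (h : requestStage r σ s = some y) :
    dyadicInterval σ ⊆ Set.Ico (∑ j ∈ Finset.range s, requestWeight (r j))
      (∑ j ∈ Finset.range (s + 1), requestWeight (r j)) := by
  obtain ⟨p, hp, -, h1, h2, h3⟩ := requestStage_eq_some h
  obtain ⟨h4, h5⟩ := subset_of_request hl hp h2 h3
  rw [dyadicInterval, h1]
  exact Set.Ico_subset_Ico h4 h5

/-- Comparable descriptions share a real number, whereas intervals owned by different stages are
disjoint. This yields both prefix-freeness and uniqueness of the output. -/
theorem eq_of_requestStage (hl : ∀ s p, r s = some p → p.1 ≤ s)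
    {σ τ x y : List Bool} {s t : ℕ} (h1 : requestStage r σ s = some x)
    (h2 : requestStage r τ t = some y) (h : σ <+: τ) : s = t := by
  have hm := left_mem_dyadicInterval τ
  have a := dyadicInterval_subset_of_request hl h1 (dyadicInterval_anti h hm)
  have b := dyadicInterval_subset_of_request hl h2 hm
  have hmono : Monotone fun s => ∑ j ∈ Finset.range s, requestWeight (r j) :=
    monotone_nat_of_le_succ fun n => by
      rw [Finset.sum_range_succ]
      linarith [requestWeight_nonneg (r n)]
  rcases lt_trichotomy s t with hst | hst | hst
  · have : _ ≤ _ := hmono (Nat.succ_le_of_lt hst)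
    exact absurd (a.2.trans_le this) (not_lt.2 b.1)
  · exact hst
  · have : _ ≤ _ := hmono (Nat.succ_le_of_lt hst)
    exact absurd (b.2.trans_le this) (not_lt.2 a.1)

/-- The **machine existence theorem** (Kraft–Chaitin), with the loss of one bit. -/
theorem exists_machine_of_requests (hr : Primrec r)
    (hl : ∀ s p, r s = some p → p.1 ≤ s)
    (hw : ∀ s, ∑ j ∈ Finset.range s, requestWeight (r j) ≤ 1) :
    ∃ M, IsPrefixFreeMachine M ∧
      ∀ s p, r s = some p → ∃ σ : List Bool, p.2 ∈ M σ ∧ σ.length = p.1 + 1 := by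
  refine ⟨fun σ => Nat.rfindOpt (requestStage r σ),
    ⟨Partrec.rfindOpt (requestStage_primrec hr).to_comp, ?_⟩, ?_⟩
  · intro σ τ h1 h2 h
    obtain ⟨s, x, hx⟩ := Nat.rfindOpt_dom.1 h1
    obtain ⟨t, y, hy⟩ := Nat.rfindOpt_dom.1 h2
    obtain rfl := eq_of_requestStage hl hx hy h
    obtain ⟨p, hp, -, hp', -⟩ := requestStage_eq_some hx
    obtain ⟨q, hq, -, hq', -⟩ := requestStage_eq_some hy
    obtain rfl := Option.some.inj (hp.symm.trans hq)
    exact h.eq_of_length (hp'.trans hq'.symm)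
  · intro s p hp
    obtain ⟨v, h2, h3⟩ : ∃ v, requestSum r s * 2 ^ (p.1 + 1) ≤ v * 2 ^ s ∧
        v * 2 ^ s < requestSum r s * 2 ^ (p.1 + 1) + 2 ^ s := by
      have hpos : 0 < 2 ^ s := by positivity
      generalize 2 ^ s = b at hpos
      generalize requestSum r s * 2 ^ (p.1 + 1) = a
      -- The ceiling of a / b.
      refine ⟨(a + b - 1) / b, ?_, ?_⟩
      · have := Nat.lt_div_mul_add (a := a + b - 1) hpos
        omega
      · have := Nat.div_mul_le_self (a + b - 1) b
        omega
    -- Total weight at most 1 keeps the interval inside [0, 1), so v is the value of a string of the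
    -- required length.
    have h4 := (subset_of_request hl hp h2 h3).2.trans (hw (s + 1))
    rw [div_le_one (by positivity)] at h4
    obtain ⟨σ, hσ, rfl⟩ := exists_binVal_eq (l := p.1 + 1) (v := v) (by
      have : v + 1 ≤ 2 ^ (p.1 + 1) := by exact_mod_cast h4
      omega)
    have hs : requestStage r σ s = some p.2 := by
      rw [requestStage, hp, Option.bind_some, if_pos ⟨hσ, h2, h3⟩]
    refine ⟨σ, ?_, hσ⟩
    obtain ⟨y, hy⟩ := Part.dom_iff_mem.1
      ((Nat.rfindOpt_dom (f := requestStage r σ)).2 ⟨s, p.2, hs⟩)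
    obtain ⟨t, ht⟩ := Nat.rfindOpt_spec hy
    obtain rfl := eq_of_requestStage hl hs ht List.prefix_rfl
    obtain rfl := Option.some.inj (hs.symm.trans ht)
    exact hy

end

/-! ### Upper bounds on complexity, and enumeration in stages -/

theorem prefixComplexity_le {U : List Bool →. List Bool} {σ x : List Bool} (h : x ∈ U σ) :
    prefixComplexity U x ≤ σ.length :=
  Nat.sInf_le ⟨σ, h, rfl⟩

theorem IsPrefixFreeMachine.map {M : List Bool →. List Bool} (hM : IsPrefixFreeMachine M)
    {f : List Bool → List Bool} (hf : Computable f) :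
    IsPrefixFreeMachine fun σ => (M σ).map f :=
  ⟨hM.partrec.map (hf.comp Computable.snd).to₂, fun σ τ h1 h2 h => hM.prefixFree σ τ h1 h2 h⟩

/-- Any string of length n can stand for n. This gives K(n) ≤ K(x) + O(1) for |x| = n, and lets
requests name n in unary. -/
theorem natString_length_computable : Computable fun x : List Bool => natString x.length :=
  natString_computable.comp Primrec.list_length.to_comp

theorem IsOptimalPrefixFreeMachine.exists_prefixComplexity_le {U M : List Bool →. List Bool}
    (hU : IsOptimalPrefixFreeMachine U) (hM : IsPrefixFreeMachine M)
    {f : List Bool → List Bool} (hf : Computable f) :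
    ∃ d : ℕ, ∀ σ x : List Bool, x ∈ M σ → prefixComplexity U (f x) ≤ σ.length + d := by
  obtain ⟨d, hd⟩ := hU.optimal _ (hM.map hf)
  refine ⟨d, fun σ x hx => ?_⟩
  obtain ⟨τ, h1, h2⟩ := hd σ _ (Part.mem_map f hx)
  exact (prefixComplexity_le h1).trans h2

/-- A primitive recursive enumeration in stages of the graph of a partial recursive function. -/
theorem Partrec.exists_stages {α β : Type*} [Primcodable α] [Primcodable β] {f : α →. β}
    (hf : Partrec f) :
    ∃ g : ℕ → ℕ → Option (α × β), Primrec₂ g ∧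
      (∀ s t e p, s ≤ t → g s e = some p → g t e = some p) ∧
      (∀ t e p, g t e = some p → Encodable.encode p.1 = e ∧ p.2 ∈ f p.1 ∧ e < t) ∧
      ∀ a, ∀ b ∈ f a, ∃ t, g t (Encodable.encode a) = some (a, b) := by
  obtain ⟨c, hc⟩ := Nat.Partrec.Code.exists_code.1 hf
  have hev : ∀ a v, v ∈ c.eval (Encodable.encode a) ↔ ∃ b ∈ f a, Encodable.encode b = v := by
    intro a v
    rw [hc]
    simp
  refine ⟨fun t e => (Encodable.decode₂ α e).bind fun a =>
    (c.evaln t e).bind fun v => (Encodable.decode (α := β) v).map fun b => (a, b), ?_, ?_, ?_, ?_⟩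
  · refine Primrec.option_bind (Primrec.decode₂.comp Primrec.snd) ?_
    refine Primrec.option_bind (Nat.Partrec.Code.primrec_evaln.comp
      (Primrec.pair (Primrec.pair (Primrec.fst.comp Primrec.fst) (Primrec.const c))
        (Primrec.snd.comp Primrec.fst))) ?_
    exact Primrec.option_map (Primrec.decode.comp Primrec.snd)
      (Primrec.pair (Primrec.snd.comp (Primrec.fst.comp Primrec.fst)) Primrec.snd)
  · intro s t e p hst h
    obtain ⟨a, ha, h⟩ := Option.bind_eq_some_iff.1 h
    obtain ⟨v, hv, h⟩ := Option.bind_eq_some_iff.1 h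
    exact Option.bind_eq_some_iff.2 ⟨a, ha, Option.bind_eq_some_iff.2
      ⟨v, Nat.Partrec.Code.evaln_mono hst hv, h⟩⟩
  · intro t e p h
    obtain ⟨a, ha, h⟩ := Option.bind_eq_some_iff.1 h
    obtain ⟨v, hv, h⟩ := Option.bind_eq_some_iff.1 h
    obtain ⟨b, hb, rfl⟩ := Option.map_eq_some_iff.1 h
    obtain rfl := Encodable.decode₂_eq_some.1 ha
    obtain ⟨b', hb', rfl⟩ := (hev a v).1 (Nat.Partrec.Code.evaln_sound hv)
    rw [Encodable.encodek] at hb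
    obtain rfl := Option.some.inj hb
    exact ⟨rfl, hb', Nat.Partrec.Code.evaln_bound hv⟩
  · intro a b hb
    obtain ⟨t, ht⟩ := Nat.Partrec.Code.evaln_complete.1 ((hev a _).2 ⟨b, hb, rfl⟩)
    refine ⟨t, Option.bind_eq_some_iff.2 ⟨a, Encodable.decode₂_encode a,
      Option.bind_eq_some_iff.2 ⟨_, ht, ?_⟩⟩⟩
    rw [Encodable.encodek]
    rfl

/-! ### Requests triggered by many short descriptions -/

/-- The descriptions of length at most `L` of strings of length `n`. -/
def shortDescriptions (U : List Bool →. List Bool) (n L : ℕ) : Set (List Bool) :=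
  {σ | ∃ x ∈ U σ, x.length = n ∧ σ.length ≤ L}

/-- The short descriptions that are enumerated before stage `t`. -/
def seenDescriptions (g : ℕ → ℕ → Option (List Bool × List Bool)) (n L t : ℕ) : List ℕ :=
  (List.range t).filter fun e =>
    (g t e).any fun p => decide (p.2.length = n) && decide (p.1.length ≤ L)

/-- Ask for a description of length `l` of `n` as soon as `4 ^ (k + 2)` descriptions of length at
most `l + k` of strings of length `n` have been enumerated. -/
def lengthRequest (g : ℕ → ℕ → Option (List Bool × List Bool)) (n l k t : ℕ) :
    Option (ℕ × List Bool) :=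
  if (seenDescriptions g n (l + k) t).length < 4 ^ (k + 2) ∧
    4 ^ (k + 2) ≤ (seenDescriptions g n (l + k) (t + 1)).length
  then some (l, (List.range n).map fun _ => true) else none

section

variable {g : ℕ → ℕ → Option (List Bool × List Bool)}

theorem mem_seenDescriptions {n L t e : ℕ} :
    e ∈ seenDescriptions g n L t ↔
      e < t ∧ ∃ p, g t e = some p ∧ p.2.length = n ∧ p.1.length ≤ L := by
  simp only [seenDescriptions, List.mem_filter, List.mem_range, Option.any_eq_true,
    Bool.and_eq_true, decide_eq_true_eq]

theorem seenDescriptions_nodup (n L t : ℕ) : (seenDescriptions g n L t).Nodup :=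
  List.nodup_range.filter _

theorem seenDescriptions_primrec (hg : Primrec₂ g) :
    Primrec fun a : ℕ × ℕ × ℕ => seenDescriptions g a.1 a.2.1 a.2.2 := by
  have hR : PrimrecRel fun (e : ℕ) (a : ℕ × ℕ × ℕ) =>
      (g a.2.2 e).any (fun p => decide (p.2.length = a.1) && decide (p.1.length ≤ a.2.1)) = true := by
    have h : Primrec fun x : ℕ × ℕ × ℕ × ℕ =>
        (g x.2.2.2 x.1).any fun p =>
          decide (p.2.length = x.2.1) && decide (p.1.length ≤ x.2.2.1) := by
      have h' := Primrec.option_casesOn (α := ℕ × ℕ × ℕ × ℕ) (β := List Bool × List Bool)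
        (σ := Bool) (o := fun x => g x.2.2.2 x.1) (f := fun _ => false)
        (g := fun x p => decide (p.2.length = x.2.1) && decide (p.1.length ≤ x.2.2.1))
        (hg.comp (Primrec.snd.comp (Primrec.snd.comp Primrec.snd)) Primrec.fst)
        (Primrec.const false)
        (Primrec.and.comp
          (PrimrecPred.decide (Primrec.eq.comp
            (Primrec.list_length.comp (Primrec.snd.comp Primrec.snd))
            (Primrec.fst.comp (Primrec.snd.comp Primrec.fst))))
          (PrimrecPred.decide (Primrec.nat_le.comp
            (Primrec.list_length.comp (Primrec.fst.comp Primrec.snd))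
            (Primrec.fst.comp (Primrec.snd.comp (Primrec.snd.comp Primrec.fst))))))
      refine h'.of_eq fun x => ?_
      cases g x.2.2.2 x.1 <;> rfl
    exact Primrec.eq.comp h (Primrec.const true)
  have h := hR.listFilter.comp (Primrec.list_range.comp
    (Primrec.snd.comp Primrec.snd : Primrec fun a : ℕ × ℕ × ℕ => a.2.2)) Primrec.id
  refine h.of_eq fun a => ?_
  simp [seenDescriptions]

theorem lengthRequest_primrec (hg : Primrec₂ g) :
    Primrec fun s : ℕ => lengthRequest g s.unpair.1.unpair.1 s.unpair.1.unpair.2.unpair.1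
      s.unpair.1.unpair.2.unpair.2 s.unpair.2 := by
  have h1 : Primrec fun s : ℕ => s.unpair.1 := Primrec.fst.comp Primrec.unpair
  have h2 : Primrec fun s : ℕ => s.unpair.2 := Primrec.snd.comp Primrec.unpair
  have hn := h1.comp h1
  have hl := h1.comp (h2.comp h1)
  have hk := h2.comp (h2.comp h1)
  have hlk := Primrec.nat_add.comp hl hk
  have h4 := primrec_nat_pow.comp (Primrec.const 4)
    (Primrec.nat_add.comp hk (Primrec.const 2))
  have hs := Primrec.list_length.comp ((seenDescriptions_primrec hg).comp
    (Primrec.pair hn (Primrec.pair hlk h2)))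
  have hs' := Primrec.list_length.comp ((seenDescriptions_primrec hg).comp
    (Primrec.pair hn (Primrec.pair hlk (Primrec.succ.comp h2))))
  exact Primrec.ite (PrimrecPred.and (Primrec.nat_lt.comp hs h4) (Primrec.nat_le.comp h4 hs'))
    (Primrec.option_some.comp (Primrec.pair hl (Primrec.list_map (Primrec.list_range.comp hn)
      (Primrec.const true).to₂))) (Primrec.const none)

theorem seenDescriptions_length_mono
    (hg : ∀ s t e p, s ≤ t → g s e = some p → g t e = some p) (n L : ℕ) :
    Monotone fun t => (seenDescriptions g n L t).length := by
  intro s t hst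
  refine List.Subperm.length_le ((seenDescriptions_nodup n L s).subperm fun e he => ?_)
  obtain ⟨h1, p, h2, h3⟩ := mem_seenDescriptions.1 he
  exact mem_seenDescriptions.2 ⟨h1.trans_le hst, p, hg _ _ _ _ hst h2, h3⟩

theorem seenDescriptions_length_le {U : List Bool →. List Bool}
    (hg : ∀ t e p, g t e = some p → Encodable.encode p.1 = e ∧ p.2 ∈ U p.1 ∧ e < t)
    (n L t : ℕ) :
    ((seenDescriptions g n L t).length : ℝ≥0∞) ≤
      ∑' σ, (shortDescriptions U n L).indicator 1 σ := by
  have hex : ∀ e ∈ (seenDescriptions g n L t).toFinset, ∃ σ ∈ shortDescriptions U n L,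
      Encodable.encode σ = e := by
    intro e he
    obtain ⟨-, p, h2, h3⟩ := mem_seenDescriptions.1 (List.mem_toFinset.1 he)
    obtain ⟨h4, h5, -⟩ := hg _ _ _ h2
    exact ⟨p.1, ⟨p.2, h5, h3⟩, h4⟩
  choose! D hD hD' using hex
  have hinj : Set.InjOn D (seenDescriptions g n L t).toFinset := fun e he e' he' h => by
    rw [← hD' e he, ← hD' e' he', h]
  calc ((seenDescriptions g n L t).length : ℝ≥0∞)
      = ∑ σ ∈ (seenDescriptions g n L t).toFinset.image D,
          (shortDescriptions U n L).indicator 1 σ := by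
        rw [Finset.sum_image hinj, Finset.sum_congr rfl fun e he =>
          Set.indicator_of_mem (hD e he) 1]
        simp [List.toFinset_card_of_nodup (seenDescriptions_nodup n L t)]
    _ ≤ _ := ENNReal.sum_le_tsum _

/-- Each of the finitely many descriptions is seen at some stage and, by `hmono`, stays seen; the
supremum of these stages serves for all. -/
theorem exists_le_seenDescriptions_length {U : List Bool →. List Bool}
    (hmono : ∀ s t e p, s ≤ t → g s e = some p → g t e = some p)
    (hsound : ∀ t e p, g t e = some p → Encodable.encode p.1 = e ∧ p.2 ∈ U p.1 ∧ e < t)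
    (hcompl : ∀ σ, ∀ x ∈ U σ, ∃ t, g t (Encodable.encode σ) = some (σ, x))
    {n L : ℕ} {F : Finset (List Bool)} (hF : ↑F ⊆ shortDescriptions U n L) :
    ∃ t, F.card ≤ (seenDescriptions g n L t).length := by
  have hex : ∀ σ ∈ F, ∃ t, Encodable.encode σ ∈ seenDescriptions g n L t := by
    intro σ hσ
    obtain ⟨x, hx, h1⟩ := hF hσ
    obtain ⟨t, ht⟩ := hcompl σ x hx
    exact ⟨t, mem_seenDescriptions.2 ⟨(hsound _ _ _ ht).2.2, _, ht, h1⟩⟩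
  choose! T hT using hex
  refine ⟨F.sup T, ?_⟩
  rw [← Finset.card_image_of_injective F (Encodable.encode_injective (α := List Bool)),
    ← List.toFinset_card_of_nodup (seenDescriptions_nodup n L _)]
  refine Finset.card_le_card fun e he => ?_
  obtain ⟨σ, hσ, rfl⟩ := Finset.mem_image.1 he
  obtain ⟨h1, p, h2, h3⟩ := mem_seenDescriptions.1 (hT σ hσ)
  have h4 := Finset.le_sup (f := T) hσ
  exact List.mem_toFinset.2 (mem_seenDescriptions.2
    ⟨h1.trans_le h4, p, hmono _ _ _ _ h4 h2, h3⟩)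

end

/-! ### The total weight of the requests -/

/-- A geometric tail starting at a - k; for a < k it is the full sum 2, and the bound has room to
spare. -/
theorem tsum_two_inv_pow_of_le (a k : ℕ) :
    ∑' l : ℕ, (if a ≤ l + k then (2⁻¹ : ℝ≥0∞) ^ l else 0) ≤ 2 * 2 ^ k * 2⁻¹ ^ a := by
  have h2 : (2 : ℝ≥0∞) * 2⁻¹ = 1 := ENNReal.mul_inv_cancel (by norm_num) (by norm_num)
  induction a generalizing k with
  | zero =>
    have : ∑' l : ℕ, (2⁻¹ : ℝ≥0∞) ^ l = 2 := by
      rw [ENNReal.tsum_geometric, ENNReal.one_sub_inv_two, inv_inv]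
    simp only [zero_le, if_true, this, pow_zero, mul_one]
    exact le_mul_of_one_le_right' (one_le_pow₀ (by norm_num))
  | succ a ih =>
    cases k with
    | zero =>
      rw [tsum_eq_zero_add' ENNReal.summable]
      have e : ∀ l : ℕ, (if a + 1 ≤ l + 1 + 0 then (2⁻¹ : ℝ≥0∞) ^ (l + 1) else 0) =
          (if a ≤ l + 0 then (2⁻¹ : ℝ≥0∞) ^ l else 0) * 2⁻¹ := by
        intro l
        by_cases h : a ≤ l <;> simp [h, pow_succ]
      simp only [e, ENNReal.tsum_mul_right]
      have := mul_le_mul_left (ih 0) (2⁻¹ : ℝ≥0∞)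
      simpa [pow_succ, mul_assoc] using this
    | succ k =>
      have e : ∀ l : ℕ, a + 1 ≤ l + (k + 1) ↔ a ≤ l + k := fun l => by omega
      simp only [e]
      refine (ih k).trans_eq ?_
      calc (2 : ℝ≥0∞) * 2 ^ k * 2⁻¹ ^ a = 2 * 2 ^ k * 2⁻¹ ^ a * (2 * 2⁻¹) := by rw [h2, mul_one]
        _ = _ := by ring

theorem tsum_comm_rev {α β γ δ : Type*} (f : α → β → γ → δ → ℝ≥0∞) :
    ∑' (a : α) (b : β) (c : γ) (d : δ), f a b c d = ∑' (d : δ) (c : γ) (b : β) (a : α), f a b c d :=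
  calc _ = ∑' (a : α) (b : β) (d : δ) (c : γ), f a b c d :=
        tsum_congr fun _ => tsum_congr fun _ => ENNReal.tsum_comm
    _ = ∑' (a : α) (d : δ) (b : β) (c : γ), f a b c d := tsum_congr fun _ => ENNReal.tsum_comm
    _ = ∑' (d : δ) (a : α) (b : β) (c : γ), f a b c d := ENNReal.tsum_comm
    _ = ∑' (d : δ) (a : α) (c : γ) (b : β), f a b c d :=
        tsum_congr fun _ => tsum_congr fun _ => ENNReal.tsum_comm
    _ = ∑' (d : δ) (c : γ) (a : α) (b : β), f a b c d := tsum_congr fun _ => ENNReal.tsum_comm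
    _ = _ := tsum_congr fun _ => tsum_congr fun _ => ENNReal.tsum_comm

/-- Summing over σ last, each σ in the domain of U contributes at most its Kraft weight, and Kraft's
inequality applies. The factor 4^(-(k+2)) outweighs the growth 2^k of the tail over l. -/
theorem tsum_shortDescriptions_le {U : List Bool →. List Bool} (hU : IsPrefixFreeMachine U) :
    ∑' (n : ℕ) (l : ℕ) (k : ℕ), 2⁻¹ ^ l * (2⁻¹ ^ (2 * k + 4) *
      ∑' σ, (shortDescriptions U n (l + k)).indicator 1 σ) ≤ (1 : ℝ≥0∞) := by
  have h2 : (2 : ℝ≥0∞) * 2⁻¹ = 1 := ENNReal.mul_inv_cancel (by norm_num) (by norm_num)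
  -- A description has one output, so it counts for at most one length n.
  have hn : ∀ σ L, ∑' n, (shortDescriptions U n L).indicator (1 : List Bool → ℝ≥0∞) σ ≤
      {σ | (U σ).Dom}.indicator (fun σ => if σ.length ≤ L then 1 else 0) σ := by
    intro σ L
    by_cases hσ : (U σ).Dom
    · rw [Set.indicator_of_mem (by exact hσ), tsum_eq_single ((U σ).get hσ).length]
      · split_ifs with hL
        · exact Set.indicator_le_self' (by simp) _
        · rw [Set.indicator_of_notMem]
          rintro ⟨x, -, -, h⟩
          exact hL h
      · intro n hne
        refine Set.indicator_of_notMem ?_ _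
        rintro ⟨x, hx, h, -⟩
        exact hne (by rw [← h, Part.get_eq_of_mem hx])
    · rw [Set.indicator_of_notMem (by exact hσ)]
      simp only [nonpos_iff_eq_zero, ENNReal.tsum_eq_zero]
      intro n
      refine Set.indicator_of_notMem ?_ _
      rintro ⟨x, hx, -⟩
      exact hσ (Part.dom_iff_mem.2 ⟨x, hx⟩)
  calc ∑' (n : ℕ) (l : ℕ) (k : ℕ), 2⁻¹ ^ l * (2⁻¹ ^ (2 * k + 4) *
      ∑' σ, (shortDescriptions U n (l + k)).indicator (1 : List Bool → ℝ≥0∞) σ)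
      = ∑' (σ : List Bool) (k : ℕ) (l : ℕ), 2⁻¹ ^ l * (2⁻¹ ^ (2 * k + 4) *
        ∑' n, (shortDescriptions U n (l + k)).indicator (1 : List Bool → ℝ≥0∞) σ) := by
        simp only [← ENNReal.tsum_mul_left]
        exact tsum_comm_rev _
    _ ≤ ∑' σ : List Bool, {σ | (U σ).Dom}.indicator (fun σ => 2⁻¹ ^ σ.length) σ := by
        refine ENNReal.tsum_le_tsum fun σ => ?_
        by_cases hσ : (U σ).Dom
        · rw [Set.indicator_of_mem (by exact hσ)]
          calc _ ≤ ∑' k : ℕ, (2⁻¹ : ℝ≥0∞) ^ (2 * k + 4) *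
                ∑' l : ℕ, (if σ.length ≤ l + k then (2⁻¹ : ℝ≥0∞) ^ l else 0) := by
                refine ENNReal.tsum_le_tsum fun k => ?_
                rw [← ENNReal.tsum_mul_left]
                refine ENNReal.tsum_le_tsum fun l => ?_
                refine (mul_le_mul_right (mul_le_mul_right (hn σ (l + k)) _) _).trans_eq ?_
                rw [Set.indicator_of_mem (by exact hσ)]
                split_ifs <;> simp [mul_comm]
            _ ≤ ∑' k : ℕ, (2⁻¹ : ℝ≥0∞) ^ (k + 1) * 2⁻¹ ^ σ.length := by
                refine ENNReal.tsum_le_tsum fun k => ?_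
                refine (mul_le_mul_right (tsum_two_inv_pow_of_le _ _) _).trans ?_
                calc (2⁻¹ : ℝ≥0∞) ^ (2 * k + 4) * (2 * 2 ^ k * 2⁻¹ ^ σ.length)
                    = (2 * 2⁻¹) ^ (k + 1) * (2⁻¹ ^ (k + 3) * 2⁻¹ ^ σ.length) := by ring
                  _ ≤ _ := by
                    rw [h2, one_pow, one_mul]
                    refine mul_le_mul_left (pow_le_pow_of_le_one zero_le ?_ (by omega)) _
                    simp
            _ = 2⁻¹ ^ σ.length := by
                rw [ENNReal.tsum_mul_right, ENNReal.tsum_geometric_add_one,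
                  ENNReal.one_sub_inv_two, inv_inv, mul_comm _ (2 : ℝ≥0∞), h2, one_mul]
        · rw [Set.indicator_of_notMem (by exact hσ), nonpos_iff_eq_zero]
          simp only [ENNReal.tsum_eq_zero]
          intro k l
          have := hn σ (l + k)
          rw [Set.indicator_of_notMem (by exact hσ), nonpos_iff_eq_zero] at this
          rw [this, mul_zero, mul_zero]
    _ = ∑' σ : {σ | (U σ).Dom}, 2⁻¹ ^ σ.1.length :=
        (tsum_subtype {σ | (U σ).Dom} fun σ : List Bool => (2⁻¹ : ℝ≥0∞) ^ σ.length).symm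
    _ ≤ 1 := kraft_inequality fun σ h1 τ h2 => hU.prefixFree σ τ h1 h2

/-- The number of seen descriptions is monotone in t and crosses the threshold at most once. If it
does, there are at least 4^(k+2) short descriptions, which pay for the single request of weight
2^(-l). -/
theorem tsum_requestWeight_le {U : List Bool →. List Bool}
    {g : ℕ → ℕ → Option (List Bool × List Bool)}
    (hmono : ∀ s t e p, s ≤ t → g s e = some p → g t e = some p)
    (hsound : ∀ t e p, g t e = some p → Encodable.encode p.1 = e ∧ p.2 ∈ U p.1 ∧ e < t)
    (n l k : ℕ) :
    ∑' t, ENNReal.ofReal (requestWeight (lengthRequest g n l k t)) ≤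
      2⁻¹ ^ l * (2⁻¹ ^ (2 * k + 4) *
        ∑' σ, (shortDescriptions U n (l + k)).indicator 1 σ) := by
  by_cases h : ∃ t, (seenDescriptions g n (l + k) t).length < 4 ^ (k + 2) ∧
    4 ^ (k + 2) ≤ (seenDescriptions g n (l + k) (t + 1)).length
  · obtain ⟨t, h1, h2⟩ := h
    rw [tsum_eq_single t]
    · rw [lengthRequest, if_pos ⟨h1, h2⟩, requestWeight, Option.elim_some,
        ENNReal.ofReal_pow (by norm_num), ENNReal.ofReal_inv_of_pos (by norm_num),
        ENNReal.ofReal_ofNat]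
      refine le_mul_of_one_le_right' ?_
      have h3 : ((4 ^ (k + 2) : ℕ) : ℝ≥0∞) ≤ _ :=
        (Nat.cast_le.2 h2).trans (seenDescriptions_length_le hsound n (l + k) (t + 1))
      have e : (4 ^ (k + 2) : ℝ≥0∞) = 2 ^ (2 * k + 4) := by
        rw [show 2 * k + 4 = 2 * (k + 2) by ring, pow_mul]
        norm_num
      calc (1 : ℝ≥0∞) = 2⁻¹ ^ (2 * k + 4) * 2 ^ (2 * k + 4) := by
            rw [← mul_pow, ENNReal.inv_mul_cancel (by norm_num) (by norm_num), one_pow]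
        _ ≤ _ := by
            rw [← e]
            push_cast at h3
            exact mul_le_mul_right h3 _
    · intro s hs
      have hm := seenDescriptions_length_mono hmono n (l + k)
      rw [lengthRequest, if_neg, requestWeight, Option.elim_none, ENNReal.ofReal_zero]
      rintro ⟨h3, h4⟩
      rcases lt_or_gt_of_ne hs with hst | hst
      · exact absurd (h4.trans (hm (Nat.succ_le_of_lt hst))) (not_le.2 h1)
      · exact absurd (h2.trans (hm (Nat.succ_le_of_lt hst))) (not_le.2 h3)
  · have h0 : ∀ t, ENNReal.ofReal (requestWeight (lengthRequest g n l k t)) = 0 := by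
      intro t
      rw [lengthRequest, if_neg fun ht => h ⟨t, ht⟩, requestWeight, Option.elim_none,
        ENNReal.ofReal_zero]
    simp [h0]

theorem tsum_unpair (f : ℕ → ℕ → ℝ≥0∞) :
    ∑' s : ℕ, f s.unpair.1 s.unpair.2 = ∑' (a : ℕ) (b : ℕ), f a b := by
  rw [← ENNReal.tsum_prod (f := f)]
  exact Nat.pairEquiv.symm.tsum_eq fun p : ℕ × ℕ => f p.1 p.2

/-! ### Chaitin's counting theorem -/

/-- Many short descriptions of strings of length `n` yield a shorter description of `n`. -/
theorem IsOptimalPrefixFreeMachine.exists_natString_le {U : List Bool →. List Bool}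
    (hU : IsOptimalPrefixFreeMachine U) :
    ∃ d : ℕ, ∀ (n l k : ℕ) (F : Finset (List Bool)), ↑F ⊆ shortDescriptions U n (l + k) →
      4 ^ (k + 2) ≤ F.card → prefixComplexity U (natString n) ≤ l + d := by
  obtain ⟨g, hg, hmono, hsound, hcompl⟩ := hU.machine.partrec.exists_stages
  obtain ⟨M, hM, hMr⟩ := exists_machine_of_requests (lengthRequest_primrec hg)
    (by
      intro s p hp
      rw [lengthRequest] at hp
      split_ifs at hp
      obtain rfl := Option.some.inj hp
      -- A stage codes ((n, (l, k)), t), so it is at least l.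
      exact (Nat.unpair_left_le _).trans ((Nat.unpair_right_le _).trans (Nat.unpair_left_le _)))
    (by
      intro N
      rw [← ENNReal.ofReal_le_one, ENNReal.ofReal_sum_of_nonneg fun _ _ => requestWeight_nonneg _]
      refine (ENNReal.sum_le_tsum _).trans ?_
      rw [tsum_unpair fun a t => ENNReal.ofReal (requestWeight
          (lengthRequest g a.unpair.1 a.unpair.2.unpair.1 a.unpair.2.unpair.2 t)),
        tsum_unpair fun n b => ∑' t, ENNReal.ofReal (requestWeight
          (lengthRequest g n b.unpair.1 b.unpair.2 t))]
      refine le_trans (ENNReal.tsum_le_tsum fun n => ?_) (tsum_shortDescriptions_le hU.machine)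
      rw [tsum_unpair fun l k => ∑' t, ENNReal.ofReal (requestWeight (lengthRequest g n l k t))]
      exact ENNReal.tsum_le_tsum fun l => ENNReal.tsum_le_tsum fun k =>
        tsum_requestWeight_le hmono hsound n l k)
  obtain ⟨d, hd⟩ := hU.exists_prefixComplexity_le hM natString_length_computable
  -- The extra 1 is the bit lost in `exists_machine_of_requests`.
  refine ⟨d + 1, fun n l k F hF hcard => ?_⟩
  obtain ⟨T, hT⟩ := exists_le_seenDescriptions_length hmono hsound hcompl hF
  have hex : ∃ t, 4 ^ (k + 2) ≤ (seenDescriptions g n (l + k) t).length := ⟨T, hcard.trans hT⟩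
  -- Nothing is seen before stage 0 and the threshold is positive, so the first crossing has a
  -- predecessor t, where the request is issued.
  obtain ⟨t, ht⟩ : ∃ t, Nat.find hex = t + 1 := by
    refine Nat.exists_eq_succ_of_ne_zero fun h0 => ?_
    have := Nat.find_spec hex
    rw [h0] at this
    simp [seenDescriptions] at this
  have h1 := Nat.find_spec hex
  have h2 := not_le.1 (Nat.find_min hex (m := t) (by omega))
  rw [ht] at h1
  obtain ⟨σ, hσ, hl⟩ := hMr (Nat.pair (Nat.pair n (Nat.pair l k)) t)
    (l, (List.range n).map fun _ => true) (by
      simp only [Nat.unpair_pair]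
      exact if_pos ⟨h2, h1⟩)
  have h3 := hd σ _ hσ
  simp only [List.length_map, List.length_range] at h3
  omega

theorem IsPrefixFreeMachine.card_le {U : List Bool →. List Bool} (hU : IsPrefixFreeMachine U)
    {m : ℕ} {F : Finset (List Bool)} (hF : ∀ σ ∈ F, (U σ).Dom ∧ σ.length ≤ m) :
    F.card ≤ 2 ^ m := by
  have h1 := kraft_inequality (S := ↑F) fun σ hσ τ hτ =>
    hU.prefixFree σ τ (hF σ hσ).1 (hF τ hτ).1
  rw [tsum_subtype (↑F : Set (List Bool)) fun σ : List Bool => (2⁻¹ : ℝ≥0∞) ^ σ.length] at h1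
  have h2 : (F.card : ℝ≥0∞) * 2⁻¹ ^ m ≤ 1 := by
    refine le_trans ?_ ((ENNReal.sum_le_tsum F).trans h1)
    rw [← nsmul_eq_mul]
    refine Finset.card_nsmul_le_sum _ _ _ fun σ hσ => ?_
    rw [Set.indicator_of_mem (by exact hσ)]
    exact pow_le_pow_of_le_one zero_le (by simp) (hF σ hσ).2
  rw [← ENNReal.inv_pow, ← div_eq_mul_inv, ENNReal.div_le_iff (by positivity) (by simp),
    one_mul] at h2
  exact_mod_cast h2

/-- **Chaitin's counting theorem**: only boundedly many strings `x` of length `n` satisfy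
`K(x) ≤ K(n) + b`. -/
theorem IsOptimalPrefixFreeMachine.exists_card_le {U : List Bool →. List Bool}
    (hU : IsOptimalPrefixFreeMachine U) :
    ∃ d : ℕ, ∀ (n b : ℕ) (F : Finset (List Bool)),
      (∀ x ∈ F, x.length = n ∧ prefixComplexity U x ≤ prefixComplexity U (natString n) + b) →
      F.card ≤ 4 ^ (b + d) := by
  obtain ⟨d, hd⟩ := hU.exists_natString_le
  refine ⟨d + 3, fun n b F hF => ?_⟩
  choose D hD hD' using hU.exists_description
  have hinj : Function.Injective D := fun x y h => Part.mem_unique (hD x) (h ▸ hD y)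
  set K := prefixComplexity U (natString n)
  by_contra! hlt
  rw [← Finset.card_image_of_injective F hinj] at hlt
  -- Chosen so that l + k = K + b would force K ≤ l + d = K - 1.
  set k := b + d + 1
  rw [show b + (d + 3) = k + 2 by omega] at hlt
  have h1 : ∀ l, K + b ≤ l + k → K ≤ l + d := fun l hl => by
    refine hd n l k (F.image D) ?_ hlt.le
    intro σ hσ
    obtain ⟨x, hx, rfl⟩ := Finset.mem_image.1 hσ
    obtain ⟨h2, h3⟩ := hF x hx
    exact ⟨x, hD x, h2, by rw [hD' x]; omega⟩
  -- The subtraction may truncate. If k ≤ K + b, this is the contradiction K ≤ K - 1. Otherwise K +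
  -- b < k, and Kraft's inequality already allows too few descriptions of length at most K + b.
  have h2 := h1 (K + b - k) (by omega)
  have h3 : (F.image D).card ≤ 2 ^ (K + b) := by
    refine hU.machine.card_le fun σ hσ => ?_
    obtain ⟨x, hx, rfl⟩ := Finset.mem_image.1 hσ
    exact ⟨Part.dom_iff_mem.2 ⟨x, hD x⟩, by rw [hD' x]; exact (hF x hx).2⟩
  have h4 : 2 ^ (K + b) ≤ 4 ^ (k + 2) := by
    rw [show 4 = 2 ^ 2 by norm_num, ← pow_mul]
    exact Nat.pow_le_pow_right (by norm_num) (by omega)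
  omega

/-! ### Cylinders and atomless measures -/

theorem cantorCylinder_ofFn {n : ℕ} (x : Fin n → Bool) :
    cantorCylinder (List.ofFn x) = (fun (Z : ℕ → Bool) (i : Fin n) => Z i) ⁻¹' {x} := by
  ext Z
  simp only [cantorCylinder, Set.mem_ofPred_eq, Set.mem_preimage, Set.mem_singleton_iff,
    funext_iff, List.getElem_ofFn, List.length_ofFn]
  exact ⟨fun h i => h i i.2, fun h i hi => h ⟨i, hi⟩⟩

theorem measurable_restrict_fin (n : ℕ) :
    Measurable fun (Z : ℕ → Bool) (i : Fin n) => Z i := by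
  fun_prop

theorem sum_measureReal_cantorCylinder (μ : Measure (ℕ → Bool)) [IsFiniteMeasure μ] (n : ℕ) :
    ∑ x : Fin n → Bool, μ.real (cantorCylinder (List.ofFn x)) = μ.real Set.univ := by
  simp only [cantorCylinder_ofFn]
  rw [sum_measureReal_preimage_singleton _ fun x _ =>
    measurable_restrict_fin n (measurableSet_singleton x)]
  simp

/-- The cylinders of a measure without atoms are uniformly small. -/
theorem exists_measure_cantorCylinder_lt {ν : Measure (ℕ → Bool)} [IsFiniteMeasure ν]
    (hν : ∀ Z, ν {Z} = 0) {δ : ℝ≥0∞} (hδ : 0 < δ) :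
    ∃ n, ∀ x : Fin n → Bool, ν (cantorCylinder (List.ofFn x)) < δ := by
  by_contra! hc
  let C : ℕ → (ℕ → Bool) → Set (ℕ → Bool) := fun n Z => {Y | ∀ i < n, Y i = Z i}
  have hCeq : ∀ n (Z : ℕ → Bool), C n Z = cantorCylinder (List.ofFn fun i : Fin n => Z i) := by
    intro n Z
    ext Y
    simp [C, cantorCylinder]
  have hanti : ∀ Z, Antitone fun n => C n Z := fun Z m n hmn Y hY i hi => hY i (hi.trans_le hmn)
  -- These sets are nested, nonempty, and closed because membership depends on n coordinates only. A
  -- common point has all its cylinders of mass at least δ, so by continuity from above it is an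
  -- atom.
  let T : ℕ → Set (ℕ → Bool) := fun n => {Z | δ ≤ ν (C n Z)}
  have hTclosed : ∀ n, IsClosed (T n) := by
    intro n
    have h : T n = (fun (Z : ℕ → Bool) (i : Fin n) => Z i) ⁻¹'
        {x | δ ≤ ν (cantorCylinder (List.ofFn x))} := by
      ext Z
      simp [T, hCeq]
    rw [h]
    exact (isClosed_discrete _).preimage (by fun_prop)
  obtain ⟨Z, hZ⟩ := IsCompact.nonempty_iInter_of_sequence_nonempty_isCompact_isClosed T
    (fun n Z hZ => hZ.trans (measure_mono (hanti Z n.le_succ)))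
    (fun n => by
      obtain ⟨x, hx⟩ := hc n
      refine ⟨fun i => if h : i < n then x ⟨i, h⟩ else false, ?_⟩
      simpa [T, hCeq] using hx)
    (hTclosed 0).isCompact hTclosed
  have hlim := tendsto_measure_iInter_atTop (μ := ν) (s := fun n => C n Z)
    (fun n => by
      rw [hCeq, cantorCylinder_ofFn]
      exact (measurable_restrict_fin n (measurableSet_singleton _)).nullMeasurableSet)
    (hanti Z) ⟨0, measure_ne_top _ _⟩
  have hZe : ⋂ n, C n Z = {Z} := by
    ext Y
    simp only [C, Set.mem_iInter, Set.mem_ofPred_eq, Set.mem_singleton_iff, funext_iff]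
    exact ⟨fun h i => h (i + 1) i i.lt_succ_self, fun h n i _ => h i⟩
  rw [hZe, hν] at hlim
  exact absurd (ge_of_tendsto' hlim fun n => Set.mem_iInter.1 hZ n) (not_le.2 hδ)

/-! ### Averaging and the conclusion -/

/-- Most of the mass lies on strings whose complexity is close to that of their length. -/
theorem exists_sum_measureReal_le {U : List Bool →. List Bool}
    (hU : IsOptimalPrefixFreeMachine U) {μ : Measure (ℕ → Bool)} [IsProbabilityMeasure μ]
    (hμ : IsKTrivialMeasure U μ) :
    ∃ C : ℝ, ∀ n b : ℕ, b * ∑ x : Fin n → Bool with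
      ¬ prefixComplexity U (List.ofFn x) ≤ prefixComplexity U (natString n) + b,
        μ.real (cantorCylinder (List.ofFn x)) ≤ C := by
  obtain ⟨c, hc⟩ := hμ
  obtain ⟨d, hd⟩ := hU.exists_prefixComplexity_le hU.machine natString_length_computable
  -- Markov's inequality for K(x) + d - K(n), which is nonnegative by the choice of d and has
  -- average at most c + d.
  refine ⟨c + d, fun n b => ?_⟩
  set K := prefixComplexity U (natString n)
  have hK : ∀ x : Fin n → Bool, (K : ℝ) ≤ prefixComplexity U (List.ofFn x) + d := by
    intro x
    obtain ⟨σ, hσ, hl⟩ := hU.exists_description (List.ofFn x)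
    have := hd σ _ hσ
    rw [List.length_ofFn, hl] at this
    exact_mod_cast this
  calc (b : ℝ) * ∑ x : Fin n → Bool with ¬ prefixComplexity U (List.ofFn x) ≤ K + b,
        μ.real (cantorCylinder (List.ofFn x))
      ≤ ∑ x : Fin n → Bool with ¬ prefixComplexity U (List.ofFn x) ≤ K + b,
        (prefixComplexity U (List.ofFn x) + d - K) * μ.real (cantorCylinder (List.ofFn x)) := by
        rw [Finset.mul_sum]
        refine Finset.sum_le_sum fun x hx => ?_
        have h1 : ((K + b : ℕ) : ℝ) ≤ prefixComplexity U (List.ofFn x) :=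
          Nat.cast_le.2 (not_le.1 (Finset.mem_filter.1 hx).2).le
        push_cast at h1
        refine mul_le_mul_of_nonneg_right ?_ measureReal_nonneg
        have : (0 : ℝ) ≤ d := d.cast_nonneg
        linarith
    _ ≤ ∑ x : Fin n → Bool,
        (prefixComplexity U (List.ofFn x) + d - K) * μ.real (cantorCylinder (List.ofFn x)) :=
        Finset.sum_le_sum_of_subset_of_nonneg (Finset.filter_subset _ _) fun x _ _ =>
          mul_nonneg (by linarith [hK x]) measureReal_nonneg
    _ = averageComplexity U μ n + d - K := by
        simp only [add_sub_assoc, add_mul, Finset.sum_add_distrib, ← Finset.mul_sum,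
          sum_measureReal_cantorCylinder, probReal_univ, averageComplexity, mul_one]
    _ ≤ c + d := by linarith [hc n]

/-- The atomless part ν has mass at most (C + 1) / b for every positive b: the simple strings are
few and have small cylinders, and the complex ones have small μ-mass. -/
theorem measure_compl_measureAtoms_eq_zero {U : List Bool →. List Bool}
    (hU : IsOptimalPrefixFreeMachine U) {μ : Measure (ℕ → Bool)} [IsProbabilityMeasure μ]
    (hμ : IsKTrivialMeasure U μ) : μ (measureAtoms μ)ᶜ = 0 := by
  obtain ⟨C, hC⟩ := exists_sum_measureReal_le hU hμ
  obtain ⟨d, hd⟩ := hU.exists_card_le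
  set ν := μ.restrict (measureAtoms μ)ᶜ
  have hν : ∀ Z, ν {Z} = 0 := by
    intro Z
    rw [Measure.restrict_apply (measurableSet_singleton Z)]
    by_cases hZ : μ {Z} = 0
    · exact measure_mono_null Set.inter_subset_left hZ
    · rw [Set.singleton_inter_eq_empty.2 (by simpa [measureAtoms, pos_iff_ne_zero] using hZ),
        measure_empty]
  have hνμ : ∀ s, ν.real s ≤ μ.real s := fun s =>
    ENNReal.toReal_mono (measure_ne_top _ _) (Measure.restrict_apply_le _ s)
  have key : ∀ b : ℕ, ν.real Set.univ * b ≤ C + 1 := by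
    intro b
    -- At most 4^(b+d) cylinders of this size have total mass at most 1/(b+1), which is below 1
    -- after multiplication by b.
    have hδ : (0 : ℝ) < 1 / (4 ^ (b + d) * (b + 1)) := by positivity
    obtain ⟨n, hn⟩ := exists_measure_cantorCylinder_lt hν (ENNReal.ofReal_pos.2 hδ)
    have h1 : ∑ x : Fin n → Bool with
        prefixComplexity U (List.ofFn x) ≤ prefixComplexity U (natString n) + b,
        ν.real (cantorCylinder (List.ofFn x)) ≤ 1 / (b + 1) := by
      have hcard := hd n b ((Finset.univ.filter fun x : Fin n → Bool =>
        prefixComplexity U (List.ofFn x) ≤ prefixComplexity U (natString n) + b).image List.ofFn)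
        (by
          intro y hy
          obtain ⟨x, hx, rfl⟩ := Finset.mem_image.1 hy
          exact ⟨List.length_ofFn, (Finset.mem_filter.1 hx).2⟩)
      rw [Finset.card_image_of_injective _ List.ofFn_injective] at hcard
      have hcard' : ((Finset.univ.filter fun x : Fin n → Bool => prefixComplexity U (List.ofFn x) ≤
        prefixComplexity U (natString n) + b).card : ℝ) ≤ 4 ^ (b + d) := by exact_mod_cast hcard
      refine (Finset.sum_le_card_nsmul _ _ _ fun x _ =>
        ENNReal.toReal_le_of_le_ofReal hδ.le (hn x).le).trans ?_
      rw [nsmul_eq_mul]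
      refine (mul_le_mul_of_nonneg_right hcard' hδ.le).trans_eq ?_
      field_simp
    have h2 := hC n b
    have h3 : ∑ x : Fin n → Bool with
        ¬ prefixComplexity U (List.ofFn x) ≤ prefixComplexity U (natString n) + b,
        ν.real (cantorCylinder (List.ofFn x)) ≤ ∑ x : Fin n → Bool with
        ¬ prefixComplexity U (List.ofFn x) ≤ prefixComplexity U (natString n) + b,
        μ.real (cantorCylinder (List.ofFn x)) := Finset.sum_le_sum fun x _ => hνμ _
    rw [← sum_measureReal_cantorCylinder ν n, ← Finset.sum_filter_add_sum_filter_not Finset.univ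
      fun x : Fin n → Bool =>
        prefixComplexity U (List.ofFn x) ≤ prefixComplexity U (natString n) + b, add_mul]
    have hb : (0 : ℝ) ≤ b := b.cast_nonneg
    have h4 := mul_le_mul_of_nonneg_right h1 hb
    have h5 := mul_le_mul_of_nonneg_right h3 hb
    have h6 : 1 / ((b : ℝ) + 1) * b ≤ 1 := by
      rw [div_mul_eq_mul_div, one_mul, div_le_one (by positivity)]
      linarith
    linarith
  have h0 : ν.real Set.univ = 0 := by
    refine le_antisymm (le_of_not_gt fun hpos => ?_) measureReal_nonneg
    obtain ⟨b, hb⟩ := exists_nat_gt ((C + 1) / ν.real Set.univ)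
    rw [div_lt_iff₀ hpos] at hb
    linarith [key b]
  rw [measureReal_eq_zero_iff, Measure.restrict_apply_univ] at h0
  exact h0

theorem mainTheorem9 (U : List Bool →. List Bool) (hU : IsOptimalPrefixFreeMachine U)
    (μ : Measure (ℕ → Bool)) [IsProbabilityMeasure μ] (hμ : IsKTrivialMeasure U μ) :
    (measureAtoms μ).Nonempty ∧ μ (measureAtoms μ)ᶜ = 0 := by
  have h := measure_compl_measureAtoms_eq_zero hU hμ
  refine ⟨Set.nonempty_iff_ne_empty.2 fun he => ?_, h⟩
  rw [he, Set.compl_empty, measure_univ] at h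
  exact one_ne_zero h
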